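/- Let $p\ge 5$ be a prime and let $G$ be a primitive, not $2$-transitive, permutation group on a finite set $\Omega$ with $|\Omega|=3p$. Suppose that the permutation character of $G$ is $\pi=1+\chi_1+\chi_2$, where $\chi_1$ and $\chi_2$ are irreducible complex characters of $G$ with $\deg\chi_1=p$ and $\deg\chi_2=2p-1$. Then there is an integer $a\ge 0$ such that either (i) $p=48a^2+30a+5$ and the subdegrees of $G$ (the lengths, counted with multiplicity, of the orbits on $\Omega$ of the stabiliser of a point) are $1,\ p+4a+1,\ 2p-4a-2$; or (ii) $p=48a^2+66a+23$ and the subdegrees of $G$ are $1,\ p-4a-3,\ 2p+4a+2$. -/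

import Mathlib

/-- The character of the permutation representation (by permutation matrices, over `ℂ`) of a
group `G` acting on a set `Ω`. -/
noncomputable def permutationCharacter (G Ω : Type*) [Group G] [MulAction G Ω] : G → ℂ :=
  (Representation.ofMulAction ℂ G Ω).character

/-- `χ` is the character of an irreducible complex matrix representation of `G`. Its degree is
`χ 1`. -/
def IsIrreducibleCharacter {G : Type*} [Group G] (χ : G → ℂ) : Prop :=
  ∃ (n : ℕ) (ρ : Representation ℂ G (Fin n → ℂ)), ρ.IsIrreducible ∧ ρ.character = χ

/-- The subdegrees of `G` on `Ω` at the point `α`, with multiplicities: the lengths of the orbits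
on `Ω` of the stabiliser of `α`. -/
noncomputable def subdegrees (G : Type*) {Ω : Type*} [Group G] [MulAction G Ω] [Finite Ω]
    (α : Ω) : Multiset ℕ :=
  letI : Fintype (MulAction.orbitRel.Quotient (MulAction.stabilizer G α) Ω) :=
    Fintype.ofFinite _
  Finset.univ.val.map
    fun o : MulAction.orbitRel.Quotient (MulAction.stabilizer G α) Ω => Nat.card o.orbit

/-! The degrees `1`, `p`, `2p - 1` are distinct, so each constituent occurs once and, by Schur's
lemma, every invariant matrix acts by a scalar on each of three summands of the space of functions
on `Ω` (`exists_actsByScalars`). Adjacency matrices of orbitals have disjoint supports, hence are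
independent, so there are at most three orbitals. As `G` is not 2-transitive, two lie off the
diagonal, and the subdegrees are `1, k, l`.

Let `A` be the matrix of one of these two, with eigenvalues `k, r, s` of multiplicities `1, p, 2p -
1`. Its square is an integral combination of the three orbital matrices, so `r` and `s` are roots of
one monic integral quadratic. With `tr A = 0` and unequal multiplicities this makes them rational,
hence integers. Then `tr A² > 0`, so the orbital is self-paired and `tr A² = 3pk`. The two trace
equations determine `p` and `k` (`three_mul_prime_arithmetic`). -/

/-! ### Multiplicity-free decomposition and Schur's lemma -/

open Representation Module in
theorem intertwiningMap_trivial_eq_zero {G V : Type*} [Group G]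
    [AddCommGroup V] [Module ℂ V] [FiniteDimensional ℂ V] (ρ : Representation ℂ G V)
    (h : ρ.IsIrreducible) (hlt : 1 < finrank ℂ V)
    (f : IntertwiningMap ρ (Representation.trivial ℂ G ℂ)) : f = 0 := by
  refine (IsIrreducible.injective_or_eq_zero f).resolve_left fun hf => ?_
  have := LinearMap.finrank_le_finrank_of_injective (f := f.toLinearMap) hf
  simp only [finrank_self] at this
  omega

open Representation Module in
/-- The multiplicity of `ρ₁` in a representation with character `1 + χ₁ + χ₂`. -/
theorem finrank_intertwiningMap_eq_one {G V V₁ V₂ : Type*} [Group G] [Finite G]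
    [AddCommGroup V] [Module ℂ V] [FiniteDimensional ℂ V]
    [AddCommGroup V₁] [Module ℂ V₁] [FiniteDimensional ℂ V₁]
    [AddCommGroup V₂] [Module ℂ V₂] [FiniteDimensional ℂ V₂]
    (ρ : Representation ℂ G V) (ρ₁ : Representation ℂ G V₁) (ρ₂ : Representation ℂ G V₂)
    (h₁ : ρ₁.IsIrreducible) (h₂ : ρ₂.IsIrreducible)
    (hχ : ρ.character = 1 + ρ₁.character + ρ₂.character)
    (hne : finrank ℂ V₁ ≠ finrank ℂ V₂) (hlt : 1 < finrank ℂ V₁) :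
    finrank ℂ (IntertwiningMap ρ₁ ρ) = 1 := by
  have := Fintype.ofFinite G
  have hG : (Nat.card G : ℂ) ≠ 0 := by simp
  have := invertibleOfNonzero hG
  have e := card_inv_mul_sum_char_mul_char_eq_finrank ρ₁ ρ
  have e0 := card_inv_mul_sum_char_mul_char_eq_finrank ρ₁ (Representation.trivial ℂ G ℂ)
  have e1 := card_inv_mul_sum_char_mul_char_eq_finrank ρ₁ ρ₁
  have e2 := card_inv_mul_sum_char_mul_char_eq_finrank ρ₁ ρ₂
  have z0 : finrank ℂ (IntertwiningMap ρ₁ (Representation.trivial ℂ G ℂ)) = 0 := by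
    have : Subsingleton (IntertwiningMap ρ₁ (Representation.trivial ℂ G ℂ)) :=
      subsingleton_of_forall_eq 0 (intertwiningMap_trivial_eq_zero ρ₁ h₁ hlt)
    exact finrank_eq_zero_of_subsingleton _ _
  have z2 : finrank ℂ (IntertwiningMap ρ₁ ρ₂) = 0 := by
    have : Subsingleton (IntertwiningMap ρ₁ ρ₂) :=
      subsingleton_of_forall_eq 0 fun f => by
        refine (IsIrreducible.bijective_or_eq_zero f).resolve_left fun hf => hne ?_
        exact (LinearEquiv.ofBijective f.toLinearMap hf).finrank_eq
    exact finrank_eq_zero_of_subsingleton _ _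
  have z1 : finrank ℂ (IntertwiningMap ρ₁ ρ₁) = 1 := IsIrreducible.finrank_intertwiningMap_self ..
  have t : (Representation.trivial ℂ G ℂ).character = 1 := by
    ext g; simp [character]
  rw [z0, t] at e0
  rw [z1] at e1
  rw [z2] at e2
  rw [hχ] at e
  simp only [Pi.add_apply, add_mul, Finset.sum_add_distrib, mul_add, e0, e1, e2] at e
  exact_mod_cast (show (finrank ℂ (IntertwiningMap ρ₁ ρ) : ℂ) = 1 by rw [← e]; simp)

open Representation Module in
/-- Equivariant decomposition of a representation with character `1 + χ₁ + χ₂`, given an invariant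
vector and an invariant functional that detects it. -/
theorem exists_equivariant_decomposition {G V V₁ V₂ : Type*} [Group G] [Finite G]
    [AddCommGroup V] [Module ℂ V] [FiniteDimensional ℂ V]
    [AddCommGroup V₁] [Module ℂ V₁] [FiniteDimensional ℂ V₁]
    [AddCommGroup V₂] [Module ℂ V₂] [FiniteDimensional ℂ V₂]
    (ρ : Representation ℂ G V) (ρ₁ : Representation ℂ G V₁) (ρ₂ : Representation ℂ G V₂)
    (h₁ : ρ₁.IsIrreducible) (h₂ : ρ₂.IsIrreducible)
    (hχ : ρ.character = 1 + ρ₁.character + ρ₂.character)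
    (hne : finrank ℂ V₁ ≠ finrank ℂ V₂) (hlt₁ : 1 < finrank ℂ V₁) (hlt₂ : 1 < finrank ℂ V₂)
    (u : V) (σ : V →ₗ[ℂ] ℂ) (hσ : ∀ g v, σ (ρ g v) = σ v) (hσu : σ u ≠ 0) :
    ∃ Φ : (ℂ × V₁ × V₂) ≃ₗ[ℂ] V, (∀ c, Φ (c, 0, 0) = c • u) ∧ (∀ y z, σ (Φ (0, y, z)) = 0) ∧
      ∀ A : V →ₗ[ℂ] V, (∀ g v, A (ρ g v) = ρ g (A v)) →
        ∃ b c : ℂ, ∀ y z, A (Φ (0, y, z)) = Φ (0, b • y, c • z) := by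
  have f₁ := finrank_intertwiningMap_eq_one ρ ρ₁ ρ₂ h₁ h₂ hχ hne hlt₁
  have f₂ := finrank_intertwiningMap_eq_one ρ ρ₂ ρ₁ h₂ h₁ (by rw [hχ]; ring) hne.symm hlt₂
  obtain ⟨φ₁, hφ₁, s₁⟩ := finrank_eq_one_iff'.1 f₁
  obtain ⟨φ₂, hφ₂, s₂⟩ := finrank_eq_one_iff'.1 f₂
  have i₁ := (IsIrreducible.injective_or_eq_zero φ₁).resolve_right hφ₁
  have i₂ := (IsIrreducible.injective_or_eq_zero φ₂).resolve_right hφ₂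
  let σ' : IntertwiningMap ρ (Representation.trivial ℂ G ℂ) :=
    ⟨σ, fun g => by ext v; simp [hσ]⟩
  have σ₁ : ∀ y, σ (φ₁ y) = 0 := fun y => congrArg (fun f => f y)
    (intertwiningMap_trivial_eq_zero ρ₁ h₁ hlt₁ (σ'.comp φ₁))
  have σ₂ : ∀ y, σ (φ₂ y) = 0 := fun y => congrArg (fun f => f y)
    (intertwiningMap_trivial_eq_zero ρ₂ h₂ hlt₂ (σ'.comp φ₂))
  let F : (ℂ × V₁ × V₂) →ₗ[ℂ] V :=
    (LinearMap.toSpanSingleton ℂ V u).coprod (φ₁.toLinearMap.coprod φ₂.toLinearMap)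
  have hF : ∀ c y z, F (c, y, z) = c • u + (φ₁ y + φ₂ z) := fun c y z => rfl
  have hdisj : ∀ y z, φ₁ y + φ₂ z = 0 → y = 0 ∧ z = 0 := by
    -- The relations `φ₁ y + φ₂ z = 0` form a subrepresentation that projects injectively to both
    -- factors. If it were nonzero, irreducibility would make both projections isomorphisms, against
    -- the unequal dimensions.
    let K : Subrepresentation (ρ₁.prod ρ₂) :=
      (φ₁.comp (IntertwiningMap.fst ℂ ρ₁ ρ₂) + φ₂.comp (IntertwiningMap.snd ℂ ρ₁ ρ₂)).ker _ _
    have hK : ∀ w, w ∈ K.toSubmodule ↔ φ₁ w.1 + φ₂ w.2 = 0 := fun w => Iff.rfl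
    let q₁ : IntertwiningMap K.toRepresentation ρ₁ :=
      ⟨LinearMap.fst ℂ V₁ V₂ ∘ₗ K.toSubmodule.subtype, fun g => rfl⟩
    let q₂ : IntertwiningMap K.toRepresentation ρ₂ :=
      ⟨LinearMap.snd ℂ V₁ V₂ ∘ₗ K.toSubmodule.subtype, fun g => rfl⟩
    have hq₁ : Function.Injective q₁.toLinearMap := by
      rw [← LinearMap.ker_eq_bot, LinearMap.ker_eq_bot']
      rintro ⟨⟨y, z⟩, h⟩ (rfl : y = 0)
      obtain rfl : z = 0 := i₂ (by simpa [hK] using h)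
      rfl
    have hq₂ : Function.Injective q₂.toLinearMap := by
      rw [← LinearMap.ker_eq_bot, LinearMap.ker_eq_bot']
      rintro ⟨⟨y, z⟩, h⟩ (rfl : z = 0)
      obtain rfl : y = 0 := i₁ (by simpa [hK] using h)
      rfl
    intro y z hyz
    let w : K.toSubmodule := ⟨(y, z), hyz⟩
    by_cases hw : w = 0
    · exact Prod.ext_iff.1 (congrArg Subtype.val hw)
    · have n₁ : q₁ ≠ 0 := fun h0 => hw (hq₁ (by rw [h0]; simp))
      have n₂ : q₂ ≠ 0 := fun h0 => hw (hq₂ (by rw [h0]; simp))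
      have b₁ := (IsIrreducible.surjective_or_eq_zero q₁).resolve_right n₁
      have b₂ := (IsIrreducible.surjective_or_eq_zero q₂).resolve_right n₂
      exact absurd ((LinearEquiv.ofBijective q₁.toLinearMap ⟨hq₁, b₁⟩).finrank_eq.symm.trans
        (LinearEquiv.ofBijective q₂.toLinearMap ⟨hq₂, b₂⟩).finrank_eq) hne
  have hinj : Function.Injective F := by
    rw [← LinearMap.ker_eq_bot, LinearMap.ker_eq_bot']
    rintro ⟨c, y, z⟩ h
    rw [hF] at h
    have hc : c = 0 := by
      have := congrArg σ h
      simpa [σ₁, σ₂, hσu] using this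
    subst hc
    obtain ⟨rfl, rfl⟩ := hdisj y z (by simpa using h)
    rfl
  have hdim : finrank ℂ (ℂ × V₁ × V₂) = finrank ℂ V := by
    have := congrFun hχ 1
    simp only [Pi.add_apply, char_one, Pi.one_apply] at this
    have : finrank ℂ V = 1 + finrank ℂ V₁ + finrank ℂ V₂ := by exact_mod_cast this
    simp [this, add_assoc]
  refine ⟨LinearEquiv.ofInjectiveOfFinrankEq F hinj hdim, fun c => ?_, fun y z => ?_,
    fun A hA => ?_⟩
  · change F _ = _
    simp [hF]
  · change σ (F _) = _
    simp [hF, σ₁, σ₂]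
  · let A' : IntertwiningMap ρ ρ := ⟨A, fun g => by ext v; simp [hA]⟩
    obtain ⟨b, hb⟩ := s₁ (A'.comp φ₁)
    obtain ⟨c, hc⟩ := s₂ (A'.comp φ₂)
    have hb' : ∀ y, A (φ₁ y) = b • φ₁ y := fun y => (congrArg (fun f => f y) hb).symm
    have hc' : ∀ y, A (φ₂ y) = c • φ₂ y := fun y => (congrArg (fun f => f y) hc).symm
    refine ⟨b, c, fun y z => ?_⟩
    change A (F _) = F _
    simp [hF, hb', hc']

/-! ### The permutation module as a space of functions -/

/-- The linear automorphism `f ↦ f ∘ g⁻¹` of the space of functions on a `G`-set. -/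
noncomputable def functionRepresentation (G Ω : Type*) [Group G] [MulAction G Ω] :
    Representation ℂ G (Ω → ℂ) where
  toFun g := LinearMap.funLeft ℂ ℂ (fun x : Ω => g⁻¹ • x)
  map_one' := by ext; simp [LinearMap.funLeft_apply]
  map_mul' g h := by ext; simp [LinearMap.funLeft_apply, mul_smul]

theorem functionRepresentation_apply {G Ω : Type*} [Group G] [MulAction G Ω] (g : G)
    (f : Ω → ℂ) (x : Ω) : functionRepresentation G Ω g f x = f (g⁻¹ • x) := rfl

theorem character_functionRepresentation (G Ω : Type*) [Group G] [MulAction G Ω] [Finite Ω] :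
    (functionRepresentation G Ω).character = permutationCharacter G Ω := by
  ext g
  let e : MonoidAlgebra ℂ Ω ≃ₗ[ℂ] (Ω → ℂ) :=
    (MonoidAlgebra.coeffLinearEquiv ℂ).trans (Finsupp.linearEquivFunOnFinite ℂ ℂ Ω)
  have : functionRepresentation G Ω g = e.conj (Representation.ofMulAction ℂ G Ω g) := by
    refine LinearMap.ext fun f => funext fun x => ?_
    obtain ⟨v, rfl⟩ := e.surjective f
    rw [LinearEquiv.conj_apply_apply, e.symm_apply_apply]
    exact (Representation.coeff_ofMulAction g v x).symm
  rw [permutationCharacter, Representation.character, Representation.character, this,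
    LinearMap.trace_conj']

/-! ### Simultaneous diagonalisation of invariant matrices -/

section ActsByScalars

variable {Ω V₁ V₂ : Type*} [Fintype Ω]
  [AddCommGroup V₁] [Module ℂ V₁] [AddCommGroup V₂] [Module ℂ V₂]

/-- The matrix `M` acts as the scalars `a`, `b`, `c` on the three summands of the
decomposition `Φ`. -/
def ActsByScalars (Φ : (ℂ × V₁ × V₂) ≃ₗ[ℂ] (Ω → ℂ)) (M : Matrix Ω Ω ℂ) (a b c : ℂ) : Prop :=
  ∀ x y z, M.mulVec (Φ (x, y, z)) = Φ (a • x, b • y, c • z)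

namespace ActsByScalars

variable {Φ : (ℂ × V₁ × V₂) ≃ₗ[ℂ] (Ω → ℂ)} {M N : Matrix Ω Ω ℂ} {a b c a' b' c' : ℂ}

theorem mul (hM : ActsByScalars Φ M a b c) (hN : ActsByScalars Φ N a' b' c') :
    ActsByScalars Φ (M * N) (a * a') (b * b') (c * c') := fun x y z => by
  rw [← Matrix.mulVec_mulVec, hN, hM]
  simp [mul_smul, mul_assoc]

theorem add (hM : ActsByScalars Φ M a b c) (hN : ActsByScalars Φ N a' b' c') :
    ActsByScalars Φ (M + N) (a + a') (b + b') (c + c') := fun x y z => by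
  rw [Matrix.add_mulVec, hN, hM, ← map_add]
  simp [add_smul, add_mul]

theorem smul (t : ℂ) (hM : ActsByScalars Φ M a b c) :
    ActsByScalars Φ (t • M) (t * a) (t * b) (t * c) := fun x y z => by
  rw [Matrix.smul_mulVec, hM, ← map_smul]
  simp [mul_smul, mul_assoc]

theorem zero : ActsByScalars Φ 0 0 0 0 := fun x y z => by
  simp [← Prod.zero_eq_mk]

theorem sum {ι : Type*} (s : Finset ι) {M : ι → Matrix Ω Ω ℂ} {a b c : ι → ℂ}
    (h : ∀ i ∈ s, ActsByScalars Φ (M i) (a i) (b i) (c i)) :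
    ActsByScalars Φ (∑ i ∈ s, M i) (∑ i ∈ s, a i) (∑ i ∈ s, b i) (∑ i ∈ s, c i) := by
  classical
  induction s using Finset.induction_on with
  | empty => simpa using zero
  | insert i s hi ih =>
    simp only [Finset.sum_insert hi]
    exact (h i (by simp)).add (ih fun j hj => h j (by simp [hj]))

theorem one [DecidableEq Ω] : ActsByScalars Φ 1 1 1 1 := fun x y z => by simp

theorem matrix_eq (hM : ActsByScalars Φ M a b c) (hN : ActsByScalars Φ N a b c) : M = N := by
  classical
  refine Matrix.toLin'.injective (LinearMap.ext fun v => ?_)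
  obtain ⟨⟨x, y, z⟩, rfl⟩ := Φ.surjective v
  rw [Matrix.toLin'_apply, Matrix.toLin'_apply, hM, hN]

theorem scalars_eq [Nontrivial V₁] [Nontrivial V₂] (hM : ActsByScalars Φ M a b c)
    (hM' : ActsByScalars Φ M a' b' c') : a = a' ∧ b = b' ∧ c = c' := by
  obtain ⟨y, hy⟩ := exists_ne (0 : V₁)
  obtain ⟨z, hz⟩ := exists_ne (0 : V₂)
  have h := Φ.injective ((hM 1 y z).symm.trans (hM' 1 y z))
  simp only [Prod.mk.injEq, smul_eq_mul, mul_one] at h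
  exact ⟨h.1, smul_left_injective ℂ hy h.2.1, smul_left_injective ℂ hz h.2.2⟩

theorem trace_eq [FiniteDimensional ℂ V₁] [FiniteDimensional ℂ V₂]
    (hM : ActsByScalars Φ M a b c) :
    M.trace = a + Module.finrank ℂ V₁ * b + Module.finrank ℂ V₂ * c := by
  classical
  let D : (ℂ × V₁ × V₂) →ₗ[ℂ] (ℂ × V₁ × V₂) :=
    (a • LinearMap.id).prodMap ((b • LinearMap.id).prodMap (c • LinearMap.id))
  have hD : Matrix.toLin' M = Φ.conj D := by
    refine LinearMap.ext fun v => ?_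
    obtain ⟨⟨x, y, z⟩, rfl⟩ := Φ.surjective v
    rw [Matrix.toLin'_apply, hM, LinearEquiv.conj_apply_apply, Φ.symm_apply_apply]
    rfl
  rw [← Matrix.trace_toLin'_eq, hD, LinearMap.trace_conj', LinearMap.trace_prodMap',
    LinearMap.trace_prodMap']
  simp
  ring

end ActsByScalars

end ActsByScalars

/-- Every invariant matrix of a transitive permutation group with character `1 + χ₁ + χ₂` acts by
scalars on the summands of a fixed decomposition. -/
theorem exists_actsByScalars {G Ω V₁ V₂ : Type*} [Group G] [Finite G] [MulAction G Ω]
    [Fintype Ω] [Nonempty Ω] [MulAction.IsPretransitive G Ω]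
    [AddCommGroup V₁] [Module ℂ V₁] [FiniteDimensional ℂ V₁]
    [AddCommGroup V₂] [Module ℂ V₂] [FiniteDimensional ℂ V₂]
    (ρ₁ : Representation ℂ G V₁) (ρ₂ : Representation ℂ G V₂)
    (h₁ : ρ₁.IsIrreducible) (h₂ : ρ₂.IsIrreducible)
    (hχ : permutationCharacter G Ω = 1 + ρ₁.character + ρ₂.character)
    (hne : Module.finrank ℂ V₁ ≠ Module.finrank ℂ V₂)
    (hlt₁ : 1 < Module.finrank ℂ V₁) (hlt₂ : 1 < Module.finrank ℂ V₂) :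
    ∃ Φ : (ℂ × V₁ × V₂) ≃ₗ[ℂ] (Ω → ℂ),
      ActsByScalars Φ (Matrix.of fun _ _ => 1) (Nat.card Ω) 0 0 ∧
      ∀ M : Matrix Ω Ω ℂ, (∀ (g : G) i j, M (g • i) (g • j) = M i j) →
        ∃ b c : ℂ, ∀ i, ActsByScalars Φ M (∑ j, M i j) b c := by
  classical
  have hone : (functionRepresentation G Ω).character = 1 + ρ₁.character + ρ₂.character := by
    rw [character_functionRepresentation, hχ]
  let σ : (Ω → ℂ) →ₗ[ℂ] ℂ := ∑ i, LinearMap.proj i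
  have σ_apply : ∀ f, σ f = ∑ i, f i := fun f => by simp [σ]
  obtain ⟨Φ, hu, hσ, hA⟩ := exists_equivariant_decomposition (functionRepresentation G Ω) ρ₁ ρ₂
    h₁ h₂ hone hne hlt₁ hlt₂ 1 σ
    (fun g f => by
      rw [σ_apply, σ_apply]
      exact Equiv.sum_comp (MulAction.toPerm g⁻¹) f)
    (by simp [σ_apply])
  have hsplit : ∀ x y z, Φ (x, y, z) = x • 1 + Φ (0, y, z) := fun x y z => by
    rw [← hu, ← map_add]; simp
  refine ⟨Φ, fun x y z => ?_, fun M hM => ?_⟩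
  · have hz : (0 : ℂ × V₁ × V₂) = (0, 0, 0) := rfl
    have hs : ∑ i, Φ (0, y, z) i = 0 := by rw [← σ_apply, hσ]
    rw [zero_smul, zero_smul, hu, hsplit, Matrix.mulVec_add]
    ext i
    simp [Matrix.mulVec, dotProduct, hs]
  · obtain ⟨b, c, hbc⟩ := hA (Matrix.toLin' M) (fun g f => by
      ext i
      rw [functionRepresentation_apply, Matrix.toLin'_apply, Matrix.toLin'_apply, Matrix.mulVec,
        Matrix.mulVec, dotProduct, dotProduct, ← Equiv.sum_comp (MulAction.toPerm g)]
      refine Finset.sum_congr rfl fun j _ => ?_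
      rw [functionRepresentation_apply, ← hM g (g⁻¹ • i)]
      simp)
    refine ⟨b, c, fun i x y z => ?_⟩
    -- The trivial summand is spanned by the constant function `1`. By transitivity all row sums of
    -- `M` agree, and their common value is the scalar there.
    have hrow : ∀ i', ∑ j, M i' j = ∑ j, M i j := fun i' => by
      obtain ⟨g, rfl⟩ := MulAction.exists_smul_eq G i i'
      rw [← Equiv.sum_comp (MulAction.toPerm g)]
      exact Finset.sum_congr rfl fun j _ => hM g i j
    rw [hsplit, hsplit (_ • x), Matrix.mulVec_add, ← hbc, Matrix.toLin'_apply]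
    congr 1
    ext i'
    simp [Matrix.mulVec, dotProduct, ← Finset.sum_mul, hrow]

/-! ### Solving the trace equations -/

/-- With `t = r + 2s` the first equation reads `k = s - pt`, and the second, divided by `p`, is a
quadratic in `s`. Its discriminant is nonnegative only for `-3 ≤ t ≤ 0`. The end values give only `k
= 0` and `k = 3p - 1`, which are excluded; the middle ones are exchanged by passing to the
complementary orbital, `s ↦ -1 - s`. -/
theorem three_mul_prime_arithmetic {p : ℕ} (hp : p.Prime) (hp5 : 5 ≤ p) {k r s : ℤ}
    (hk : 1 ≤ k) (hk' : k ≤ 3 * p - 2) (htr : k + p * r + (2 * p - 1) * s = 0)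
    (htr2 : k ^ 2 + p * r ^ 2 + (2 * p - 1) * s ^ 2 = 3 * p * k) :
    ∃ a : ℕ,
      (p = 48 * a ^ 2 + 30 * a + 5 ∧ (k = p + 4 * a + 1 ∨ k = 2 * p - 4 * a - 2)) ∨
      (p = 48 * a ^ 2 + 66 * a + 23 ∧ (k = p - 4 * a - 3 ∨ k = 2 * p + 4 * a + 2)) := by
  have hp0 : (5 : ℤ) ≤ p := by exact_mod_cast hp5
  have hodd : (p : ℤ) % 2 = 1 := by
    have := hp.eq_two_or_odd
    omega
  have key : ∀ s : ℤ, 6 * s ^ 2 + 3 * s + 1 = 2 * p → ∃ a : ℕ,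
      (p = 48 * a ^ 2 + 30 * a + 5 ∧ s = 4 * a + 1) ∨
      (p = 48 * a ^ 2 + 66 * a + 23 ∧ s = -(4 * a + 3)) := by
    intro s hs
    -- Since `p` is odd, `2p ≡ 2` modulo 4, and only this residue of `s` is compatible. The sign of
    -- `s` then separates the two families.
    have h4 : s % 4 = 1 := by
      have hq := Int.mul_ediv_add_emod s 4
      have h0 := Int.emod_nonneg s (show (4 : ℤ) ≠ 0 by norm_num)
      have h3 := Int.emod_lt_of_pos s (show (0 : ℤ) < 4 by norm_num)
      generalize s % 4 = m at *
      generalize s / 4 = q at *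
      subst hq
      ring_nf at hs
      interval_cases m <;> ring_nf at hs <;> omega
    rcases le_or_gt 0 s with h | h
    · obtain ⟨a, ha⟩ := Int.eq_ofNat_of_zero_le (show 0 ≤ s / 4 by omega)
      have : s = 4 * a + 1 := by omega
      refine ⟨a, Or.inl ⟨?_, this⟩⟩
      subst this
      zify
      linarith
    · obtain ⟨a, ha⟩ := Int.eq_ofNat_of_zero_le (show 0 ≤ -(s + 3) / 4 by omega)
      have : s = -(4 * a + 3) := by omega
      refine ⟨a, Or.inr ⟨?_, this⟩⟩
      subst this
      zify
      linarith
  obtain ⟨t, rfl⟩ : ∃ t, r = t - 2 * s := ⟨r + 2 * s, by ring⟩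
  obtain rfl : k = s - p * t := by linarith
  have hquad : 6 * s ^ 2 - 3 * (2 * t + 1) * s + t ^ 2 + p * (t * (t + 3)) = 0 := by
    have : (p : ℤ) * (6 * s ^ 2 - 3 * (2 * t + 1) * s + t ^ 2 + p * (t * (t + 3))) = 0 := by
      linarith
    exact (mul_eq_zero.1 this).resolve_left (by positivity)
  have hdisc : (12 - 24 * (p : ℤ)) * (t * (t + 3)) + 9 ≥ 0 := by
    nlinarith [sq_nonneg (12 * s - 3 * (2 * t + 1))]
  have ht : t * (t + 3) ≤ 0 := by nlinarith
  have ht1 : t ≤ 0 := by nlinarith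
  have ht2 : -3 ≤ t := by nlinarith
  obtain rfl | rfl | rfl | rfl : t = 0 ∨ t = -1 ∨ t = -2 ∨ t = -3 := by omega
  · have : s * (2 * s - 1) = 0 := by linarith
    rcases mul_eq_zero.1 this with h | h <;> omega
  · obtain ⟨a, ⟨h, h'⟩ | ⟨h, h'⟩⟩ := key s (by linarith)
    · exact ⟨a, Or.inl ⟨h, Or.inl (by linarith)⟩⟩
    · exact ⟨a, Or.inr ⟨h, Or.inl (by linarith)⟩⟩
  · obtain ⟨a, ⟨h, h'⟩ | ⟨h, h'⟩⟩ := key (-1 - s) (by linarith)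
    · exact ⟨a, Or.inl ⟨h, Or.inr (by linarith)⟩⟩
    · exact ⟨a, Or.inr ⟨h, Or.inr (by linarith)⟩⟩
  · have : (s + 1) * (2 * s + 3) = 0 := by linarith
    rcases mul_eq_zero.1 this with h | h <;> omega

/-! ### Orbitals and subdegrees -/

section OrbitalMatrix

variable (G : Type*) {Ω : Type*} [Group G] [MulAction G Ω]

open Classical in
/-- The adjacency matrix of the orbital containing the pair `x`. -/
noncomputable def orbitalMatrix (x : Ω × Ω) : Matrix Ω Ω ℂ :=
  Matrix.of fun i j => if (i, j) ∈ MulAction.orbit G x then 1 else 0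

variable {G}

theorem smul_pair_mem_orbit_iff (x : Ω × Ω) (g : G) (i j : Ω) :
    (g • i, g • j) ∈ MulAction.orbit G x ↔ (i, j) ∈ MulAction.orbit G x := by
  rw [← MulAction.orbit_eq_iff, ← MulAction.orbit_eq_iff (a := (i, j)),
    ← MulAction.orbit_smul g (i, j)]
  rfl

theorem orbitalMatrix_smul (x : Ω × Ω) (g : G) (i j : Ω) :
    orbitalMatrix G x (g • i) (g • j) = orbitalMatrix G x i j := by
  classical exact if_congr (smul_pair_mem_orbit_iff x g i j) rfl rfl

variable [Fintype Ω]

open Classical in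
theorem orbitalMatrix_row_sum (x : Ω × Ω) (i : Ω) :
    ∑ j, orbitalMatrix G x i j = Nat.card {j // (i, j) ∈ MulAction.orbit G x} := by
  simp [orbitalMatrix, Fintype.card_subtype]

variable {V₁ V₂ : Type*} [AddCommGroup V₁] [Module ℂ V₁] [AddCommGroup V₂] [Module ℂ V₂]

/-- There are at most three orbitals if all orbital matrices act by scalars. -/
theorem card_orbitals_le_three {Φ : (ℂ × V₁ × V₂) ≃ₗ[ℂ] (Ω → ℂ)}
    (hΦ : ∀ M : Matrix Ω Ω ℂ, (∀ (g : G) i j, M (g • i) (g • j) = M i j) →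
      ∃ a b c : ℂ, ActsByScalars Φ M a b c) :
    Nat.card (MulAction.orbitRel.Quotient G (Ω × Ω)) ≤ 3 := by
  classical
  let Q := MulAction.orbitRel.Quotient G (Ω × Ω)
  have : Fintype Q := Fintype.ofFinite _
  let A : Q → Matrix Ω Ω ℂ := fun q => orbitalMatrix G q.out
  have hA : ∀ q, ∃ v : ℂ × ℂ × ℂ, ActsByScalars Φ (A q) v.1 v.2.1 v.2.2 := fun q => by
    obtain ⟨a, b, c, h⟩ := hΦ (A q) (orbitalMatrix_smul _)
    exact ⟨(a, b, c), h⟩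
  choose v hv using hA
  -- A relation between the scalar triples is a relation between the matrices; its entry at a
  -- representative of an orbital isolates one coefficient.
  have hli : LinearIndependent ℂ v := by
    rw [Fintype.linearIndependent_iff]
    intro f hf q
    have h1 := ActsByScalars.sum Finset.univ fun i _ => (hv i).smul (f i)
    have e1 : ∑ i, f i * (v i).1 = 0 := by
      simpa [Prod.fst_sum] using congrArg Prod.fst hf
    have e2 : ∑ i, f i * (v i).2.1 = 0 := by
      simpa [Prod.fst_sum, Prod.snd_sum] using congrArg (fun w => w.2.1) hf
    have e3 : ∑ i, f i * (v i).2.2 = 0 := by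
      simpa [Prod.fst_sum, Prod.snd_sum] using congrArg (fun w => w.2.2) hf
    rw [e1, e2, e3] at h1
    have h2 := congrFun (congrFun (h1.matrix_eq ActsByScalars.zero) q.out.1) q.out.2
    simp only [Matrix.sum_apply, Matrix.smul_apply, Matrix.zero_apply, smul_eq_mul] at h2
    rw [Finset.sum_eq_single q] at h2
    · simpa [A, orbitalMatrix] using h2
    · intro q' _ hq'
      have : ((q.out.1, q.out.2) : Ω × Ω) ∉ MulAction.orbit G q'.out := fun h => hq' <| by
        rw [← Quotient.out_eq q', ← Quotient.out_eq q]
        exact (Quotient.sound (MulAction.orbitRel_apply.2 h)).symm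
      simp [A, orbitalMatrix, this]
    · simp
  simpa [Nat.card_eq_fintype_card] using hli.fintype_card_le_finrank

end OrbitalMatrix

/-- A permutation group with at most three orbitals that is transitive but not 2-transitive has
exactly two orbitals off the diagonal. -/
theorem exists_two_orbitals {G Ω : Type*} [Group G] [MulAction G Ω] [Finite Ω]
    (h3 : Nat.card (MulAction.orbitRel.Quotient G (Ω × Ω)) ≤ 3)
    (hnot2 : ¬ MulAction.IsMultiplyPretransitive G Ω 2) :
    ∃ x y : Ω × Ω, x.1 ≠ x.2 ∧ y.1 ≠ y.2 ∧ x ∉ MulAction.orbit G y ∧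
      ∀ i j, i ≠ j → (i, j) ∈ MulAction.orbit G x ∨ (i, j) ∈ MulAction.orbit G y := by
  classical
  rw [MulAction.is_two_pretransitive_iff] at hnot2
  push Not at hnot2
  obtain ⟨a, b, c, d, hab, hcd, hno⟩ := hnot2
  have hxy : (a, b) ∉ MulAction.orbit G (c, d) := by
    rw [← MulAction.orbitRel_apply]
    intro h
    obtain ⟨g, hg⟩ := MulAction.orbitRel_apply.1 ((MulAction.orbitRel G (Ω × Ω)).symm' h)
    simp only [Prod.smul_mk, Prod.mk.injEq] at hg
    exact hno g hg.1 hg.2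
  refine ⟨(a, b), (c, d), hab, hcd, hxy, fun i j hij => ?_⟩
  by_contra! hcon
  have hdiag : ∀ (u : Ω) (i j : Ω), i ≠ j → (u, u) ∉ MulAction.orbit G (i, j) := by
    rintro u i j hij ⟨g, hg⟩
    simp only [Prod.smul_mk, Prod.mk.injEq] at hg
    exact hij (smul_left_cancel g (hg.1.trans hg.2.symm))
  have : Fintype (MulAction.orbitRel.Quotient G (Ω × Ω)) := Fintype.ofFinite _
  have hne : ∀ w z : Ω × Ω, w ∉ MulAction.orbit G z →
      (Quotient.mk'' w : MulAction.orbitRel.Quotient G (Ω × Ω)) ≠ Quotient.mk'' z :=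
    fun w z h e => h (MulAction.orbitRel_apply.1 (Quotient.exact e))
  have hcard : ({Quotient.mk'' (a, a), Quotient.mk'' (a, b), Quotient.mk'' (c, d),
      Quotient.mk'' (i, j)} : Finset (MulAction.orbitRel.Quotient G (Ω × Ω))).card = 4 := by
    have e1 := hne _ _ (hdiag a a b hab)
    have e2 := hne _ _ (hdiag a c d hcd)
    have e3 := hne _ _ (hdiag a i j hij)
    have e4 := hne _ _ hxy
    have e5 := (hne _ _ hcon.1).symm
    have e6 := (hne _ _ hcon.2).symm
    rw [Finset.card_insert_of_notMem, Finset.card_insert_of_notMem, Finset.card_pair e6]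
    · simp [e4, e5]
    · simp [e1, e2, e3]
  have := Finset.card_le_univ ({Quotient.mk'' (a, a), Quotient.mk'' (a, b), Quotient.mk'' (c, d),
      Quotient.mk'' (i, j)} : Finset (MulAction.orbitRel.Quotient G (Ω × Ω)))
  rw [hcard, ← Nat.card_eq_fintype_card] at this
  omega

/-- The subdegrees of a transitive group with exactly two orbitals off the diagonal. -/
theorem subdegrees_eq {G Ω : Type*} [Group G] [MulAction G Ω] [Finite Ω]
    [MulAction.IsPretransitive G Ω] {x y : Ω × Ω} (hx : x.1 ≠ x.2) (hy : y.1 ≠ y.2)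
    (hxy : x ∉ MulAction.orbit G y)
    (hcov : ∀ i j, i ≠ j → (i, j) ∈ MulAction.orbit G x ∨ (i, j) ∈ MulAction.orbit G y)
    (α : Ω) :
    subdegrees G α = {1, Nat.card {j // (α, j) ∈ MulAction.orbit G x},
      Nat.card {j // (α, j) ∈ MulAction.orbit G y}} := by
  classical
  have hex : ∀ z : Ω × Ω, ∃ β, (α, β) ∈ MulAction.orbit G z := fun z => by
    obtain ⟨g, hg⟩ := MulAction.exists_smul_eq G z.1 α
    exact ⟨g • z.2, g, by rw [← hg]; rfl⟩
  have horb : ∀ (z : Ω × Ω) (β γ : Ω), (α, β) ∈ MulAction.orbit G z →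
      (γ ∈ MulAction.orbit (MulAction.stabilizer G α) β ↔ (α, γ) ∈ MulAction.orbit G z) := by
    intro z β γ hβ
    rw [← MulAction.orbit_eq_iff.2 hβ]
    constructor
    · rintro ⟨⟨g, hg⟩, rfl⟩
      exact ⟨g, Prod.ext hg rfl⟩
    · rintro ⟨g, hg⟩
      simp only [Prod.smul_mk, Prod.mk.injEq] at hg
      exact ⟨⟨g, hg.1⟩, hg.2⟩
  obtain ⟨β, hβ⟩ := hex x
  obtain ⟨γ, hγ⟩ := hex y
  have hne : ∀ z : Ω × Ω, z.1 ≠ z.2 → (α, α) ∉ MulAction.orbit G z := by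
    rintro z hz ⟨g, hg⟩
    exact hz (smul_left_cancel g ((congrArg Prod.fst hg).trans (congrArg Prod.snd hg).symm))
  have hγx : (α, γ) ∉ MulAction.orbit G x := fun h => hxy <| by
    rw [← MulAction.orbit_eq_iff.2 hγ, MulAction.orbit_eq_iff.2 h]
    exact MulAction.mem_orbit_self x
  let Q := MulAction.orbitRel.Quotient (MulAction.stabilizer G α) Ω
  let mk : Ω → Q := Quotient.mk''
  have hmk : ∀ u v, mk u = mk v ↔ u ∈ MulAction.orbit (MulAction.stabilizer G α) v :=
    fun u v => Quotient.eq''.trans MulAction.orbitRel_apply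
  let _ : Fintype Q := Fintype.ofFinite _
  have h1 : mk α ≠ mk β := fun h => hne x hx ((horb x β α hβ).1 ((hmk _ _).1 h))
  have h2 : mk α ≠ mk γ := fun h => hne y hy ((horb y γ α hγ).1 ((hmk _ _).1 h))
  have h3 : mk β ≠ mk γ := fun h => hγx ((horb x β γ hβ).1 ((hmk _ _).1 h.symm))
  have huniv : (Finset.univ : Finset Q) = {mk α, mk β, mk γ} := by
    ext q
    induction q using Quotient.inductionOn' with | _ δ
    simp only [Finset.mem_univ, Finset.mem_insert, Finset.mem_singleton, true_iff]
    by_cases hδ : α = δ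
    · exact Or.inl (congrArg mk hδ.symm)
    · rcases hcov α δ hδ with h | h
      · exact Or.inr (Or.inl ((hmk _ _).2 ((horb x β δ hβ).2 h)))
      · exact Or.inr (Or.inr ((hmk _ _).2 ((horb y γ δ hγ).2 h)))
  have hval : (Finset.univ : Finset Q).val = {mk α, mk β, mk γ} := by
    rw [huniv, Finset.insert_val_of_notMem (by simp [h1, h2]),
      Finset.insert_val_of_notMem (by simp [h3])]
    rfl
  have hcard : ∀ (z : Ω × Ω) (δ : Ω), (α, δ) ∈ MulAction.orbit G z →
      Nat.card (mk δ).orbit = Nat.card {j // (α, j) ∈ MulAction.orbit G z} := fun z δ hδ =>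
    Nat.card_congr (Equiv.subtypeEquivRight fun j => horb z δ j hδ)
  have hα : Nat.card (mk α).orbit = 1 := by
    rw [hcard (α, α) α (MulAction.mem_orbit_self _), Nat.card_eq_one_iff_unique]
    refine ⟨⟨?_⟩, ⟨α, MulAction.mem_orbit_self _⟩⟩
    have : ∀ j : {j // (α, j) ∈ MulAction.orbit G (α, α)}, j.1 = α := by
      rintro ⟨j, g, hg⟩
      exact (congrArg Prod.snd hg).symm.trans (congrArg Prod.fst hg)
    exact fun u v => Subtype.ext ((this u).trans (this v).symm)
  change (Finset.univ : Finset Q).val.map _ = _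
  rw [hval, ← hcard x β hβ, ← hcard y γ hγ, ← hα]
  rfl

/-! ### Integral eigenvalues of an orbital -/

theorem Complex.exists_int_eq_of_rational_of_quadratic {z : ℂ} {m n u v : ℤ} (hm : m ≠ 0)
    (h : (m : ℂ) * z = n) (h2 : z ^ 2 = u * z + v) : ∃ t : ℤ, z = t := by
  have hm' : (m : ℂ) ≠ 0 := by exact_mod_cast hm
  have hz : z = algebraMap ℚ ℂ (n / m : ℚ) := by
    rw [show z = n / m from eq_div_of_mul_eq hm' (by rw [mul_comm]; exact h)]
    simp
  have hint : IsIntegral ℤ z := by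
    open Polynomial in
    refine ⟨X ^ 2 - (C u * X + C v), ?_, ?_⟩
    · monicity!
    · rw [eval₂_sub, eval₂_X_pow, eval₂_add, eval₂_mul, eval₂_X, eval₂_C, eval₂_C, h2]
      simp
  rw [hz, isIntegral_algebraMap_iff (algebraMap ℚ ℂ).injective] at hint
  obtain ⟨t, ht⟩ := IsIntegrallyClosed.isIntegral_iff.1 hint
  exact ⟨t, by rw [hz, ← ht]; simp⟩

/-- Integrality of two algebraic conjugates from a trace relation with distinct multiplicities. -/
theorem exists_int_eigenvalues {b c : ℂ} {k m n β δ : ℤ} (hm : 0 < m) (hn : 0 < n) (hmn : m ≠ n)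
    (htr : (k : ℂ) + m * b + n * c = 0) (hb : b ^ 2 = β * b + δ) (hc : c ^ 2 = β * c + δ) :
    ∃ r s : ℤ, b = r ∧ c = s := by
  obtain ⟨s, rfl⟩ : ∃ s : ℤ, c = s := by
    -- Equal roots give `(m + n)c = -k`; distinct ones have sum `β`, giving `(n - m)c = -k - mβ`.
    -- Either way `c` is rational.
    by_cases hbc : b = c
    · subst hbc
      refine Complex.exists_int_eq_of_rational_of_quadratic (m := m + n) (n := -k) (by omega) ?_ hc
      push_cast
      linear_combination htr
    · have hsum : b + c = β := by
        refine mul_left_cancel₀ (sub_ne_zero.2 hbc) ?_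
        linear_combination hb - hc
      refine Complex.exists_int_eq_of_rational_of_quadratic (m := n - m) (n := -k - m * β)
        (by omega) ?_ hc
      push_cast
      linear_combination htr - m * hsum
  obtain ⟨r, rfl⟩ := Complex.exists_int_eq_of_rational_of_quadratic (m := m) (n := -k - n * s)
    hm.ne' (by push_cast; linear_combination htr) hb
  exact ⟨r, s, rfl, rfl⟩

-- Entries of the square count paths of length two, so they are integers; this makes the quadratic
-- for the eigenvalues integral.
open Classical in
theorem orbitalMatrix_mul_apply {G Ω : Type*} [Group G] [MulAction G Ω] [Fintype Ω] (x : Ω × Ω)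
    (i j : Ω) : (orbitalMatrix G x * orbitalMatrix G x) i j =
      ((Finset.univ.filter fun m => (i, m) ∈ MulAction.orbit G x ∧
        (m, j) ∈ MulAction.orbit G x).card : ℂ) := by
  simp [Matrix.mul_apply, orbitalMatrix, ← ite_and, and_comm]

/-- The eigenvalues of an orbital of a transitive group with two orbitals off the diagonal whose
orbital matrices act by scalars on summands of dimensions `1 ≠ m ≠ n`. -/
theorem exists_orbital_eigenvalues {G Ω V₁ V₂ : Type*} [Group G] [MulAction G Ω]
    [Fintype Ω] [MulAction.IsPretransitive G Ω]
    [AddCommGroup V₁] [Module ℂ V₁] [FiniteDimensional ℂ V₁]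
    [AddCommGroup V₂] [Module ℂ V₂] [FiniteDimensional ℂ V₂]
    (hne : Module.finrank ℂ V₁ ≠ Module.finrank ℂ V₂)
    (hpos₁ : 0 < Module.finrank ℂ V₁) (hpos₂ : 0 < Module.finrank ℂ V₂)
    {Φ : (ℂ × V₁ × V₂) ≃ₗ[ℂ] (Ω → ℂ)}
    (hJ : ActsByScalars Φ (Matrix.of fun _ _ => 1) (Nat.card Ω) 0 0)
    (hΦ : ∀ M : Matrix Ω Ω ℂ, (∀ (g : G) i j, M (g • i) (g • j) = M i j) →
        ∃ b c : ℂ, ∀ i, ActsByScalars Φ M (∑ j, M i j) b c)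
    {x y : Ω × Ω} (hx : x.1 ≠ x.2) (hy : y.1 ≠ y.2) (hxy : x ∉ MulAction.orbit G y)
    (hcov : ∀ i j, i ≠ j → (i, j) ∈ MulAction.orbit G x ∨ (i, j) ∈ MulAction.orbit G y) :
    ∃ k l : ℕ, (∀ i, Nat.card {j // (i, j) ∈ MulAction.orbit G x} = k) ∧
      (∀ i, Nat.card {j // (i, j) ∈ MulAction.orbit G y} = l) ∧
      0 < k ∧ 0 < l ∧ 1 + k + l = Nat.card Ω ∧
      ∃ r s : ℤ, (k : ℤ) + Module.finrank ℂ V₁ * r + Module.finrank ℂ V₂ * s = 0 ∧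
        (k : ℤ) ^ 2 + Module.finrank ℂ V₁ * r ^ 2 + Module.finrank ℂ V₂ * s ^ 2 =
          Nat.card Ω * k := by
  classical
  have n₁ : Nontrivial V₁ := Module.nontrivial_of_finrank_pos hpos₁
  have n₂ : Nontrivial V₂ := Module.nontrivial_of_finrank_pos hpos₂
  set A := orbitalMatrix G x with hAdef
  set B := orbitalMatrix G y with hBdef
  have hdiag : ∀ z : Ω × Ω, z.1 ≠ z.2 → ∀ i, (i, i) ∉ MulAction.orbit G z := by
    rintro z hz i ⟨g, hg⟩
    exact hz (smul_left_cancel g ((congrArg Prod.fst hg).trans (congrArg Prod.snd hg).symm))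
  have hdisj : ∀ w, w ∈ MulAction.orbit G x → w ∉ MulAction.orbit G y := fun w h h' => hxy <| by
    rw [← MulAction.orbit_eq_iff.2 h', MulAction.orbit_eq_iff.2 h]
    exact MulAction.mem_orbit_self x
  have hABJ : 1 + A + B = Matrix.of fun _ _ => 1 := by
    ext i j
    by_cases hij : i = j
    · subst hij
      simp [hAdef, hBdef, orbitalMatrix, hdiag x hx, hdiag y hy]
    · rcases hcov i j hij with h | h
      · simp [hAdef, hBdef, orbitalMatrix, hij, h, hdisj _ h]
      · have h' : (i, j) ∉ MulAction.orbit G x := fun h' => hdisj _ h' h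
        simp [hAdef, hBdef, orbitalMatrix, hij, h, h']
  obtain ⟨b, c, hA⟩ := hΦ A (orbitalMatrix_smul x)
  obtain ⟨b', c', hB⟩ := hΦ B (orbitalMatrix_smul y)
  simp only [hAdef, hBdef, orbitalMatrix_row_sum] at hA hB
  rw [← hAdef] at hA
  rw [← hBdef] at hB
  set i₀ := x.1
  set k := Nat.card {j // (i₀, j) ∈ MulAction.orbit G x} with hk
  set l := Nat.card {j // (i₀, j) ∈ MulAction.orbit G y} with hl
  have hkl := ((ActsByScalars.one.add (hA i₀)).add (hB i₀)).scalars_eq (hABJ ▸ hJ)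
  obtain ⟨e1, e2, e3⟩ := hkl
  have hk0 : 0 < k := Nat.card_pos_iff.2 ⟨⟨⟨x.2, MulAction.mem_orbit_self x⟩⟩, inferInstance⟩
  have hl0 : 0 < l := by
    obtain ⟨g, hg⟩ := MulAction.exists_smul_eq G y.1 i₀
    exact Nat.card_pos_iff.2 ⟨⟨⟨g • y.2, g, by rw [← hg]; rfl⟩⟩, inferInstance⟩
  obtain ⟨f, hf⟩ : ∃ f : Ω → Ω → ℤ, ∀ i j, (A * A) i j = f i j :=
    ⟨_, fun i j => by rw [hAdef, orbitalMatrix_mul_apply]; exact (Int.cast_natCast _).symm⟩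
  have hAA : ∀ (g : G) i j, (A * A) (g • i) (g • j) = (A * A) i j := fun g i j => by
    rw [Matrix.mul_apply, Matrix.mul_apply, ← Equiv.sum_comp (MulAction.toPerm g)]
    exact Finset.sum_congr rfl fun m _ => by
      simp only [MulAction.toPerm_apply, hAdef, orbitalMatrix_smul]
  have hAAdiag : ∀ i, (A * A) i i = f i₀ i₀ := fun i => by
    obtain ⟨g, rfl⟩ := MulAction.exists_smul_eq G i₀ i
    rw [hAA, hf]
  have hAAorb : ∀ z : Ω × Ω, ∀ i j, (i, j) ∈ MulAction.orbit G z → (A * A) i j = f z.1 z.2 := by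
    rintro z i j ⟨g, hg⟩
    obtain rfl : g • z.1 = i := congrArg Prod.fst hg
    obtain rfl : g • z.2 = j := congrArg Prod.snd hg
    rw [hAA, hf]
  have hAAeq : A * A = (f i₀ i₀ : ℂ) • (1 : Matrix Ω Ω ℂ) + (f x.1 x.2 : ℂ) • A +
      (f y.1 y.2 : ℂ) • B := by
    ext i j
    by_cases hij : i = j
    · subst hij
      rw [hAAdiag]
      simp [hAdef, hBdef, orbitalMatrix, hdiag x hx, hdiag y hy]
    · rcases hcov i j hij with h | h
      · rw [hAAorb x i j h]
        simp [hAdef, hBdef, orbitalMatrix, hij, h, hdisj _ h]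
      · have h' : (i, j) ∉ MulAction.orbit G x := fun h' => hdisj _ h' h
        rw [hAAorb y i j h]
        simp [hAdef, hBdef, orbitalMatrix, hij, h, h']
  have hAAact := (hA i₀).mul (hA i₀)
  obtain ⟨-, q1, q2⟩ := (hAAeq ▸ hAAact).scalars_eq
    (((ActsByScalars.one.smul _).add ((hA i₀).smul _)).add ((hB i₀).smul _))
  have htr := (hA i₀).trace_eq
  have htr2 := hAAact.trace_eq
  have htrA : A.trace = 0 := by
    simp [Matrix.trace, hAdef, orbitalMatrix, hdiag x hx]
  rw [htrA] at htr
  -- The other orbital's eigenvalues are `-1 - b` and `-1 - c`, because the all-ones matrix vanishes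
  -- on both nontrivial summands. Eliminating them from the formula for `A * A` yields `β` and `δ`.
  obtain ⟨r, s, rfl, rfl⟩ := exists_int_eigenvalues (b := b) (c := c) (k := k)
    (m := Module.finrank ℂ V₁) (n := Module.finrank ℂ V₂) (β := f x.1 x.2 - f y.1 y.2)
    (δ := f i₀ i₀ - f y.1 y.2) (by exact_mod_cast hpos₁) (by exact_mod_cast hpos₂)
    (by exact_mod_cast hne) (by push_cast; exact htr.symm)
    (by push_cast; linear_combination q1 + f y.1 y.2 * e2)
    (by push_cast; linear_combination q2 + f y.1 y.2 * e3)
  have htrAA : (A * A).trace = Nat.card Ω * f i₀ i₀ := by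
    simp [Matrix.trace, hAAdiag]
  have hf0 : f i₀ i₀ = ((Finset.univ.filter fun m => (i₀, m) ∈ MulAction.orbit G x ∧
        (m, i₀) ∈ MulAction.orbit G x).card : ℤ) := by
    have := (hf i₀ i₀).symm.trans (orbitalMatrix_mul_apply x i₀ i₀)
    exact_mod_cast this
  rw [htrAA] at htr2
  have htr2' : (Nat.card Ω : ℤ) * f i₀ i₀ =
      k * k + Module.finrank ℂ V₁ * (r * r) + Module.finrank ℂ V₂ * (s * s) := by
    exact_mod_cast htr2
  have hfk : f i₀ i₀ = k := by
    by_cases hsym : ∃ u v, (u, v) ∈ MulAction.orbit G x ∧ (v, u) ∈ MulAction.orbit G x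
    · obtain ⟨u, v, huv, hvu⟩ := hsym
      have hswap : ∀ m, (i₀, m) ∈ MulAction.orbit G x → (m, i₀) ∈ MulAction.orbit G x := by
        intro m hm
        rw [← MulAction.orbit_eq_iff.2 huv] at hm
        obtain ⟨g, hg⟩ := hm
        obtain ⟨h1, h2⟩ := Prod.mk.inj hg
        rw [← h1, ← h2]
        exact (smul_pair_mem_orbit_iff x g v u).2 hvu
      rw [hf0, hk, Nat.card_eq_fintype_card, Fintype.card_subtype]
      congr 2
      ext m
      simpa using hswap m
    -- An orbital that is not self-paired has `tr A² = 0`, impossible for a sum of squares of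
    -- integers with `k > 0`.
    · exfalso
      have : f i₀ i₀ = 0 := by
        rw [hf0, Nat.cast_eq_zero, Finset.card_eq_zero, Finset.filter_eq_empty_iff]
        exact fun m _ hm => hsym ⟨i₀, m, hm⟩
      rw [this] at htr2'
      have : (0 : ℤ) < k := by exact_mod_cast hk0
      nlinarith [mul_nonneg (Int.natCast_nonneg (Module.finrank ℂ V₁)) (mul_self_nonneg r),
        mul_nonneg (Int.natCast_nonneg (Module.finrank ℂ V₂)) (mul_self_nonneg s)]
  refine ⟨k, l, fun i => ?_, fun i => ?_, hk0, hl0, by exact_mod_cast e1, r, s, ?_, ?_⟩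
  · exact_mod_cast ((hA i).scalars_eq (hA i₀)).1
  · exact_mod_cast ((hB i).scalars_eq (hB i₀)).1
  · exact_mod_cast htr.symm
  · rw [hfk] at htr2'
    linear_combination -htr2'

/-! ### The main theorem -/

theorem mainTheorem3 {Ω : Type*} [Finite Ω] (G : Subgroup (Equiv.Perm Ω)) (p : ℕ)
    (hp : p.Prime) (hp5 : 5 ≤ p) (hdeg : Nat.card Ω = 3 * p)
    (hprim : MulAction.IsPreprimitive G Ω)
    (hnot2 : ¬ MulAction.IsMultiplyPretransitive G Ω 2)
    (χ₁ χ₂ : G → ℂ) (hχ₁ : IsIrreducibleCharacter χ₁) (hχ₂ : IsIrreducibleCharacter χ₂)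
    (hd₁ : χ₁ 1 = (p : ℂ)) (hd₂ : χ₂ 1 = 2 * (p : ℂ) - 1)
    (hπ : permutationCharacter G Ω = 1 + χ₁ + χ₂) :
    ∃ a : ℕ,
      (p = 48 * a ^ 2 + 30 * a + 5 ∧
        ∀ α : Ω, (subdegrees G α).map (fun n : ℕ => (n : ℤ)) =
          {1, (p : ℤ) + 4 * a + 1, 2 * (p : ℤ) - 4 * a - 2}) ∨
      (p = 48 * a ^ 2 + 66 * a + 23 ∧
        ∀ α : Ω, (subdegrees G α).map (fun n : ℕ => (n : ℤ)) =
          {1, (p : ℤ) - 4 * a - 3, 2 * (p : ℤ) + 4 * a + 2}) := by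
  have := Fintype.ofFinite Ω
  have : Nonempty Ω := (Nat.card_pos_iff.1 (by omega)).1
  have : MulAction.IsPretransitive G Ω := hprim.toIsPretransitive
  obtain ⟨n₁, ρ₁, h₁, rfl⟩ := hχ₁
  obtain ⟨n₂, ρ₂, h₂, rfl⟩ := hχ₂
  rw [Representation.char_one] at hd₁ hd₂
  have d₁ : Module.finrank ℂ (Fin n₁ → ℂ) = p := by exact_mod_cast hd₁
  have d₂ : (Module.finrank ℂ (Fin n₂ → ℂ) : ℤ) = 2 * p - 1 := by exact_mod_cast hd₂
  obtain ⟨Φ, hJ, hΦ⟩ := exists_actsByScalars ρ₁ ρ₂ h₁ h₂ hπ (by omega) (by omega) (by omega)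
  have h3 : Nat.card (MulAction.orbitRel.Quotient G (Ω × Ω)) ≤ 3 :=
    card_orbitals_le_three (Φ := Φ) fun M hM =>
      let ⟨b, c, h⟩ := hΦ M hM
      ⟨_, b, c, h (Classical.arbitrary Ω)⟩
  obtain ⟨x, y, hx, hy, hxy, hcov⟩ := exists_two_orbitals h3 hnot2
  obtain ⟨k, l, hk, hl, hk0, hl0, hkl, r, s, htr, htr2⟩ :=
    exists_orbital_eigenvalues (by omega) (by omega) (by omega) hJ hΦ hx hy hxy hcov
  rw [d₁, d₂] at htr htr2
  rw [hdeg] at hkl htr2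
  -- The bound `k ≤ 3p - 2` comes from `l > 0`.
  obtain ⟨a, ha⟩ := three_mul_prime_arithmetic hp hp5 (k := k) (by omega) (by omega) htr
    (by rw [htr2]; push_cast; ring)
  have hsub : ∀ α : Ω, (subdegrees G α).map (fun n : ℕ => (n : ℤ)) = {1, (k : ℤ), (l : ℤ)} :=
    fun α => by
      rw [subdegrees_eq hx hy hxy hcov α, hk, hl]
      simp
  -- The orbital labelled `x` may carry either nontrivial subdegree, so both orders are needed.
  have hsub' : ∀ α : Ω, (subdegrees G α).map (fun n : ℕ => (n : ℤ)) = {1, (l : ℤ), (k : ℤ)} :=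
    fun α => by rw [hsub, Multiset.pair_comm]
  have hl' : (l : ℤ) = 3 * p - 1 - k := by omega
  refine ⟨a, ha.imp (fun h => ⟨h.1, fun α => ?_⟩) fun h => ⟨h.1, fun α => ?_⟩⟩
  · rcases h.2 with h | h
    · rw [hsub, hl', h]; ring_nf
    · rw [hsub', hl', h]; ring_nf
  · rcases h.2 with h | h
    · rw [hsub, hl', h]; ring_nf
    · rw [hsub', hl', h]; ring_nf
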